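/- **Theorem 8.4** ($PC(f)=\Theta(QC(f))$). There are absolute constants $a,b>0$ such that for all finite sets $X,Y$ and every function $f:X\times Y\to\{0,1\}$ both complexities below are well defined (there is at least one classical and at least one quantum weakly unbounded error protocol for $f$), and $$a\cdot QC(f)\;\le\; PC(f)\;\le\; b\cdot QC(f).$$ Here Alice receives $x\in X$, Bob receives $y\in Y$, and the worst case error of a protocol is the maximum over all inputs $(x,y)$ of the probability that its output differs from $f(x,y)$. A protocol has weakly unbounded error for $f$ if its worst case error is $1/2-\delta$ with $\delta>0$; if its worst case communication is $c$, then its cost is $c-\lfloor\log_2\delta\rfloor$. $PC(f)$ is the minimum cost of a classical randomized two-party protocol of this kind: each player has finitely many private uniformly random bits, the players exchange bits according to a protocol tree whose leaves are labeled by the output, and $c$ is the depth of the tree. $QC(f)$ is the minimum cost of a quantum protocol of this kind, without prior entanglement: each player has finitely many qubits, some of which initially hold the player's input, encoded injectively as a bit string, while all others are in the state $|0\rangle$; in each round one player applies a unitary transformation to the qubits in his possession and then sends one of them to the other player; the choices of the player, the unitary transformation and the qubit sent are fixed in advance; after the last round one fixed qubit is measured in the computational basis and the result is the output; $c$ is the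 number of qubits sent. -/

import Mathlib

namespace CommComplexity

/-- The cost `c - ⌊log₂ δ⌋` of a protocol with worst case communication `c` and worst case
error `err = 1/2 - δ`. It is used only when `err < 1/2`, that is, when `δ > 0`. -/
noncomputable def weaklyUnboundedCost (c : ℕ) (err : ℝ) : ℤ :=
  (c : ℤ) - ⌊Real.logb 2 (1 / 2 - err)⌋

/-! ### Classical protocols -/

/-- A deterministic two-party protocol tree, where Alice holds an element of `A` and Bob one of
`B`. At an inner node the owner of the node sends one bit, a function of what the owner holds;
the bit selects the subtree (the first one for `false`, the second one for `true`).
A leaf is labeled by the output. -/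
inductive ProtocolTree (A : Type*) (B : Type*)
  | leaf (output : Bool) : ProtocolTree A B
  | alice (message : A → Bool) (next₀ next₁ : ProtocolTree A B) : ProtocolTree A B
  | bob (message : B → Bool) (next₀ next₁ : ProtocolTree A B) : ProtocolTree A B

namespace ProtocolTree

variable {A B : Type*}

/-- The output of the protocol. -/
def run : ProtocolTree A B → A → B → Bool
  | leaf output, _, _ => output
  | alice message next₀ next₁, a, b => if message a then next₁.run a b else next₀.run a b
  | bob message next₀ next₁, a, b => if message b then next₁.run a b else next₀.run a b

/-- The number of bits exchanged in the worst case. -/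
def depth : ProtocolTree A B → ℕ
  | leaf _ => 0
  | alice _ next₀ next₁ => max next₀.depth next₁.depth + 1
  | bob _ next₀ next₁ => max next₀.depth next₁.depth + 1

end ProtocolTree

/-- A randomized protocol with private coins: besides the inputs, Alice holds `coinsA` and Bob
holds `coinsB` independent uniformly random bits that the other player does not see. -/
structure RandomizedProtocol (X : Type*) (Y : Type*) where
  coinsA : ℕ
  coinsB : ℕ
  tree : ProtocolTree (X × (Fin coinsA → Bool)) (Y × (Fin coinsB → Bool))

namespace RandomizedProtocol

variable {X Y : Type*}

/-- The worst case communication. -/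
def comm (P : RandomizedProtocol X Y) : ℕ := P.tree.depth

/-- The probability, over the coins of both players, of the output `b` on input `(x, y)`. -/
noncomputable def outputProb (P : RandomizedProtocol X Y) (x : X) (y : Y) (b : Bool) : ℝ :=
  ((Finset.univ.filter fun r : (Fin P.coinsA → Bool) × (Fin P.coinsB → Bool) =>
      P.tree.run (x, r.1) (y, r.2) = b).card : ℝ) / 2 ^ (P.coinsA + P.coinsB)

/-- The worst case, over all inputs, of the probability of a wrong output. -/
noncomputable def error (P : RandomizedProtocol X Y) (f : X → Y → Bool) : ℝ :=
  ⨆ p : X × Y, P.outputProb p.1 p.2 (!f p.1 p.2)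

end RandomizedProtocol

/-- The costs of all classical weakly unbounded error protocols for `f`. -/
def classicalCosts {X Y : Type*} (f : X → Y → Bool) : Set ℕ :=
  {k | ∃ P : RandomizedProtocol X Y,
    P.error f < 1 / 2 ∧ (k : ℤ) = weaklyUnboundedCost P.comm (P.error f)}

/-- The classical weakly unbounded error communication complexity of `f`. -/
noncomputable def PC {X Y : Type*} (f : X → Y → Bool) : ℕ := sInf (classicalCosts f)

/-! ### Quantum protocols -/

/-- The two players. -/
inductive Player
  | alice
  | bob
  deriving DecidableEq

/-- The opponent of a player. -/
def Player.other : Player → Player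
  | .alice => .bob
  | .bob => .alice

section Quantum

variable {Q : Type} [Fintype Q] [DecidableEq Q]

/-- A state of the qubits `Q`, by its amplitudes in the computational basis. -/
abbrev QState (Q : Type) : Type := (Q → Bool) → ℂ

/-- The basis state `|s⟩`. -/
def basisState (s : Q → Bool) : QState Q := fun t => if t = s then 1 else 0

/-- The qubits that player `p` possesses, when `own` tells the owner of each qubit. -/
abbrev Owned (own : Q → Player) (p : Player) : Type := {i : Q // own i = p}

/-- The operator `U ⊗ 1`, where `U` acts on the qubits possessed by `p` and the identity acts on
the qubits of the other player, applied to the state `ψ`. -/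
noncomputable def applyLocal (own : Q → Player) (p : Player)
    (U : Matrix (Owned own p → Bool) (Owned own p → Bool) ℂ) (ψ : QState Q) : QState Q :=
  fun s => ∑ t : Owned own p → Bool,
    U (fun i => s i.1) t * ψ (fun i => if h : own i = p then t ⟨i, h⟩ else s i)

/-- The part of a quantum protocol that remains to be carried out while the possession of the
qubits is given by the index. In a round, player `p` applies a unitary transformation to the
qubits in the possession of `p` and then sends one of them, `sent`, to the other player.
At the end the qubit `out` is measured. All choices are fixed in advance. -/
inductive QRounds (Q : Type) [Fintype Q] [DecidableEq Q] : (Q → Player) → Type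
  | finish (own : Q → Player) (out : Q) : QRounds Q own
  | round (own : Q → Player) (p : Player)
      (U : Matrix.unitaryGroup (Owned own p → Bool) ℂ)
      (sent : Q) (h : own sent = p)
      (rest : QRounds Q (Function.update own sent p.other)) : QRounds Q own

namespace QRounds

/-- The number of qubits exchanged. -/
def length {own : Q → Player} : QRounds Q own → ℕ
  | finish _ _ => 0
  | round _ _ _ _ _ rest => rest.length + 1

/-- The probability that the final measurement gives `b`, starting from the state `ψ`. -/
noncomputable def outputProb {own : Q → Player} : QRounds Q own → QState Q → Bool → ℝ
  | finish _ out, ψ, b => ∑ s : Q → Bool, if s out = b then ‖ψ s‖ ^ 2 else 0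
  | round own p U _ _ rest, ψ, b => rest.outputProb (applyLocal own p U.1 ψ) b

end QRounds

/-- The qubits of a protocol: Alice's `nA` input qubits and `wA` work qubits, and Bob's `nB` input
qubits and `wB` work qubits. -/
abbrev Qubits (nA wA nB wB : ℕ) : Type := (Fin nA ⊕ Fin wA) ⊕ (Fin nB ⊕ Fin wB)

/-- The possession of the qubits before the first round. -/
def initialOwner (nA wA nB wB : ℕ) : Qubits nA wA nB wB → Player :=
  Sum.elim (fun _ => .alice) (fun _ => .bob)

/-- A quantum protocol without prior entanglement. The inputs are written as bit strings into the
input qubits by the encodings `encA` and `encB`. -/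
structure QuantumProtocol (X : Type*) (Y : Type*) where
  nA : ℕ
  wA : ℕ
  nB : ℕ
  wB : ℕ
  encA : X → Fin nA → Bool
  encA_injective : Function.Injective encA
  encB : Y → Fin nB → Bool
  encB_injective : Function.Injective encB
  rounds : QRounds (Qubits nA wA nB wB) (initialOwner nA wA nB wB)

namespace QuantumProtocol

variable {X Y : Type*}

/-- The number of qubits exchanged. -/
def comm (P : QuantumProtocol X Y) : ℕ := P.rounds.length

/-- The initial state on `(x, y)`: the input qubits hold the inputs, all others are `|0⟩`. -/
def initialState (P : QuantumProtocol X Y) (x : X) (y : Y) :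
    QState (Qubits P.nA P.wA P.nB P.wB) :=
  basisState (Sum.elim (Sum.elim (P.encA x) fun _ => false) (Sum.elim (P.encB y) fun _ => false))

/-- The probability of the output `b` on input `(x, y)`. -/
noncomputable def outputProb (P : QuantumProtocol X Y) (x : X) (y : Y) (b : Bool) : ℝ :=
  P.rounds.outputProb (P.initialState x y) b

/-- The worst case, over all inputs, of the probability of a wrong output. -/
noncomputable def error (P : QuantumProtocol X Y) (f : X → Y → Bool) : ℝ :=
  ⨆ p : X × Y, P.outputProb p.1 p.2 (!f p.1 p.2)

end QuantumProtocol

end Quantum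

/-- The costs of all quantum weakly unbounded error protocols for `f`. -/
def quantumCosts {X Y : Type*} (f : X → Y → Bool) : Set ℕ :=
  {k | ∃ P : QuantumProtocol X Y,
    P.error f < 1 / 2 ∧ (k : ℤ) = weaklyUnboundedCost P.comm (P.error f)}

/-- The quantum weakly unbounded error communication complexity of `f`. -/
noncomputable def QC {X Y : Type*} (f : X → Y → Bool) : ℕ := sInf (quantumCosts f)

end CommComplexity

/-! Both models are compared with one combinatorial quantity: `SignDecomposition f m δ` writes the
sign of `f`, with margin `δ`, as a sum of `2 ^ m` bounded product functions.

A classical protocol with `c` bits yields `m = c`: its leaves are rectangles, and averaging over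
private coins keeps the products (`RandomizedProtocol.signDecomposition`). A quantum protocol with
`c` qubits yields `m = 2 * c + 1`: each qubit sent at most doubles the number of product terms
needed for the joint state (`SplitState.send`), and the output bias is quadratic in the state
(`SplitState.bilinearSum_finish`).

Conversely, a decomposition gives a protocol in which Alice sends a uniformly random index `k` and a
random sign of mean `u x k`, and Bob multiplies by a random sign of mean `v y k`. The bias is the
sum divided by `2 ^ m`, so the logarithm of the margin drops by only `m + O(1)`. The quantum version
puts square roots of the probabilities into amplitudes.

Thus each cost is at most linear in the other plus a constant, and the constant is absorbed since
every cost exceeds its communication (`comm_lt_weaklyUnboundedCost`). Both sets of costs are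
nonempty because every `f` is decomposed by the indicators of the elements of `X`. -/

namespace CommComplexity

/-! ### Sign decompositions -/

/-- The value `1` for `true` and `-1` for `false`. -/
def boolSign (b : Bool) : ℝ := if b then 1 else -1

@[simp] theorem boolSign_true : boolSign true = 1 := rfl

@[simp] theorem boolSign_false : boolSign false = -1 := rfl

theorem boolSign_mul_self (b : Bool) : boolSign b * boolSign b = 1 := by
  cases b <;> simp

theorem abs_boolSign (b : Bool) : |boolSign b| = 1 := by
  cases b <;> simp

theorem boolSign_beq (a b : Bool) : boolSign (a == b) = boolSign a * boolSign b := by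
  cases a <;> cases b <;> simp

/-- The function `f` is, with margin `δ`, the sign of a sum of `2 ^ m` products of a function of
the first and a function of the second argument, all of them bounded by `1`. -/
def SignDecomposition {X Y : Type*} (f : X → Y → Bool) (m : ℕ) (δ : ℝ) : Prop :=
  ∃ (u : X → (Fin m → Bool) → ℝ) (v : Y → (Fin m → Bool) → ℝ),
    (∀ x k, |u x k| ≤ 1) ∧ (∀ y k, |v y k| ≤ 1) ∧
      ∀ x y, δ ≤ boolSign (f x y) * ∑ k, u x k * v y k

theorem SignDecomposition.of_fintype {X Y : Type*} {f : X → Y → Bool} {m : ℕ} {δ : ℝ}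
    {K : Type*} [Fintype K] (hK : Fintype.card K ≤ 2 ^ m) (u : X → K → ℝ) (v : Y → K → ℝ)
    (hu : ∀ x k, |u x k| ≤ 1) (hv : ∀ y k, |v y k| ≤ 1)
    (h : ∀ x y, δ ≤ boolSign (f x y) * ∑ k, u x k * v y k) : SignDecomposition f m δ := by
  classical
  obtain ⟨e⟩ : Nonempty (K ↪ (Fin m → Bool)) :=
    Function.Embedding.nonempty_of_card_le (by simpa using hK)
  refine ⟨fun x => Function.extend e (u x) 0, fun y => Function.extend e (v y) 0, ?_, ?_, ?_⟩
  · intro x k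
    by_cases hk : ∃ a, e a = k
    · obtain ⟨a, rfl⟩ := hk
      simpa [e.injective.extend_apply] using hu x a
    · simp [Function.extend_apply' _ _ _ hk]
  · intro y k
    by_cases hk : ∃ a, e a = k
    · obtain ⟨a, rfl⟩ := hk
      simpa [e.injective.extend_apply] using hv y a
    · simp [Function.extend_apply' _ _ _ hk]
  · intro x y
    convert h x y using 2
    symm
    apply Finset.sum_of_injOn e e.injective.injOn (by simp)
    · intro k _ hk
      have : ¬ ∃ a, e a = k := by simpa using hk
      simp [Function.extend_apply' _ _ _ this]
    · intro k _
      simp [e.injective.extend_apply]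

theorem exists_signDecomposition {X Y : Type*} [Finite X] (f : X → Y → Bool) :
    ∃ m, SignDecomposition f m 1 := by
  classical
  have := Fintype.ofFinite X
  obtain ⟨m, hm⟩ : ∃ m, Fintype.card X ≤ 2 ^ m := ⟨_, Nat.lt_two_pow_self.le⟩
  refine ⟨m, .of_fintype hm (fun x k => if x = k then 1 else 0) (fun y k => boolSign (f k y))
    ?_ ?_ ?_⟩
  · intro x k
    split_ifs <;> simp
  · intro y k
    exact (abs_boolSign _).le
  · intro x y
    simp [boolSign_mul_self]

/-! ### From classical protocols to sign decompositions -/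

/-- The index set is the set of leaves. The inputs reaching a leaf form a rectangle, whose indicator
is a product; an inner node multiplies only its owner's factor by an indicator. -/
theorem ProtocolTree.exists_expansion {A B : Type*} (T : ProtocolTree A B) :
    ∃ (K : Type) (_ : Fintype K) (α : A → K → ℝ) (β : B → K → ℝ),
      Fintype.card K ≤ 2 ^ T.depth ∧ (∀ a k, |α a k| ≤ 1) ∧ (∀ b k, |β b k| ≤ 1) ∧
        ∀ a b, boolSign (T.run a b) = ∑ k, α a k * β b k := by
  induction T with
  | leaf output =>
    exact ⟨Unit, inferInstance, fun _ _ => boolSign output, fun _ _ => 1,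
      by simp [ProtocolTree.depth], fun _ _ => (abs_boolSign _).le, by simp, by simp [ProtocolTree.run]⟩
  | alice message next₀ next₁ ih₀ ih₁ =>
    obtain ⟨K₀, _, α₀, β₀, hK₀, hα₀, hβ₀, h₀⟩ := ih₀
    obtain ⟨K₁, _, α₁, β₁, hK₁, hα₁, hβ₁, h₁⟩ := ih₁
    refine ⟨K₀ ⊕ K₁, inferInstance,
      fun a => Sum.elim (fun k => if message a then 0 else α₀ a k)
        (fun k => if message a then α₁ a k else 0),
      fun b => Sum.elim (β₀ b) (β₁ b), ?_, ?_, ?_, ?_⟩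
    · have h0 : 2 ^ next₀.depth ≤ 2 ^ max next₀.depth next₁.depth :=
        Nat.pow_le_pow_right two_pos (le_max_left _ _)
      have h1 : 2 ^ next₁.depth ≤ 2 ^ max next₀.depth next₁.depth :=
        Nat.pow_le_pow_right two_pos (le_max_right _ _)
      rw [Fintype.card_sum, ProtocolTree.depth, pow_succ]
      omega
    · rintro a (k | k) <;> simp only [Sum.elim_inl, Sum.elim_inr] <;> split_ifs <;> simp [*]
    · rintro b (k | k) <;> simp [*]
    · intro a b
      rw [ProtocolTree.run]
      split_ifs <;> simp [*]
  | bob message next₀ next₁ ih₀ ih₁ =>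
    obtain ⟨K₀, _, α₀, β₀, hK₀, hα₀, hβ₀, h₀⟩ := ih₀
    obtain ⟨K₁, _, α₁, β₁, hK₁, hα₁, hβ₁, h₁⟩ := ih₁
    refine ⟨K₀ ⊕ K₁, inferInstance,
      fun a => Sum.elim (α₀ a) (α₁ a),
      fun b => Sum.elim (fun k => if message b then 0 else β₀ b k)
        (fun k => if message b then β₁ b k else 0), ?_, ?_, ?_, ?_⟩
    · have h0 : 2 ^ next₀.depth ≤ 2 ^ max next₀.depth next₁.depth :=
        Nat.pow_le_pow_right two_pos (le_max_left _ _)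
      have h1 : 2 ^ next₁.depth ≤ 2 ^ max next₀.depth next₁.depth :=
        Nat.pow_le_pow_right two_pos (le_max_right _ _)
      rw [Fintype.card_sum, ProtocolTree.depth, pow_succ]
      omega
    · rintro a (k | k) <;> simp [*]
    · rintro b (k | k) <;> simp only [Sum.elim_inl, Sum.elim_inr] <;> split_ifs <;> simp [*]
    · intro a b
      rw [ProtocolTree.run]
      split_ifs <;> simp [*]

theorem abs_coin_average_le_one {n : ℕ} (g : (Fin n → Bool) → ℝ) (hg : ∀ r, |g r| ≤ 1) :
    |(∑ r, g r) / 2 ^ n| ≤ 1 := by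
  rw [abs_div, abs_of_pos (by positivity : (0 : ℝ) < 2 ^ n), div_le_one (by positivity)]
  calc |∑ r, g r| ≤ ∑ r, |g r| := Finset.abs_sum_le_sum_abs _ _
    _ ≤ ∑ _r : Fin n → Bool, (1 : ℝ) := Finset.sum_le_sum fun r _ => hg r
    _ = 2 ^ n := by simp

namespace RandomizedProtocol

variable {X Y : Type*}

/-- The expectation of the sign of the output. -/
noncomputable def bias (P : RandomizedProtocol X Y) (x : X) (y : Y) : ℝ :=
  (∑ r : Fin P.coinsA → Bool, ∑ r' : Fin P.coinsB → Bool,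
    boolSign (P.tree.run (x, r) (y, r'))) / 2 ^ (P.coinsA + P.coinsB)

theorem outputProb_not (P : RandomizedProtocol X Y) (x : X) (y : Y) (b : Bool) :
    P.outputProb x y (!b) = (1 - boolSign b * P.bias x y) / 2 := by
  have key : ((Finset.univ.filter fun r : (Fin P.coinsA → Bool) × (Fin P.coinsB → Bool) =>
      P.tree.run (x, r.1) (y, r.2) = !b).card : ℝ) =
      (2 ^ (P.coinsA + P.coinsB) - boolSign b * ∑ r : Fin P.coinsA → Bool,
        ∑ r' : Fin P.coinsB → Bool, boolSign (P.tree.run (x, r) (y, r'))) / 2 := by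
    have hc : (2 : ℝ) ^ (P.coinsA + P.coinsB) =
        ∑ _r : (Fin P.coinsA → Bool) × (Fin P.coinsB → Bool), (1 : ℝ) := by
      simp [pow_add]
    rw [hc, ← Fintype.sum_prod_type', Finset.mul_sum, ← Finset.sum_sub_distrib, Finset.sum_div,
      Finset.card_filter, Nat.cast_sum]
    refine Finset.sum_congr rfl fun r _ => ?_
    cases b <;> cases P.tree.run (x, r.1) (y, r.2) <;> norm_num
  rw [outputProb, key, bias]
  field_simp

theorem outputProb_le_error [Finite X] [Finite Y] (P : RandomizedProtocol X Y)
    (f : X → Y → Bool) (x : X) (y : Y) : P.outputProb x y (!f x y) ≤ P.error f :=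
  le_ciSup (f := fun p : X × Y => P.outputProb p.1 p.2 (!f p.1 p.2))
    (Set.finite_range _).bddAbove (x, y)

theorem error_nonneg (P : RandomizedProtocol X Y) (f : X → Y → Bool) : 0 ≤ P.error f :=
  Real.iSup_nonneg fun p => by unfold outputProb; positivity

/-- Since the coins are private and independent, the expectation of each leaf's product is the
product of the two averages. The true margin `1 - 2 * P.error f` is weakened to the one in the
definition of the cost. -/
theorem signDecomposition [Finite X] [Finite Y] (P : RandomizedProtocol X Y) (f : X → Y → Bool)
    (h : P.error f < 1 / 2) : SignDecomposition f P.comm (1 / 2 - P.error f) := by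
  obtain ⟨K, _, α, β, hK, hα, hβ, hT⟩ := P.tree.exists_expansion
  refine .of_fintype hK (fun x k => (∑ r, α (x, r) k) / 2 ^ P.coinsA)
    (fun y k => (∑ r, β (y, r) k) / 2 ^ P.coinsB) (fun x k => abs_coin_average_le_one _ fun r => hα _ _)
    (fun y k => abs_coin_average_le_one _ fun r => hβ _ _) fun x y => ?_
  have hb : ∑ k, (∑ r, α (x, r) k) / 2 ^ P.coinsA * ((∑ r, β (y, r) k) / 2 ^ P.coinsB) =
      P.bias x y := by
    simp only [bias, hT, Finset.sum_div, div_mul_div_comm, ← pow_add, Finset.sum_mul_sum]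
    rw [Finset.sum_comm]
    refine Finset.sum_congr rfl fun r _ => ?_
    rw [Finset.sum_comm]
  rw [hb]
  have := P.outputProb_le_error f x y
  rw [outputProb_not] at this
  linarith

end RandomizedProtocol

/-! ### From sign decompositions to classical protocols -/

/-- Alice spells out `g a` bit by bit; the extra level is Bob's announcement of the output. -/
theorem ProtocolTree.exists_oneWay {A B : Type*} (n : ℕ) (g : A → Fin n → Bool)
    (h : B → (Fin n → Bool) → Bool) :
    ∃ T : ProtocolTree A B, T.depth = n + 1 ∧ ∀ a b, T.run a b = h b (g a) := by
  induction n with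
  | zero =>
    refine ⟨.bob (fun b => h b Fin.elim0) (.leaf false) (.leaf true), rfl, fun a b => ?_⟩
    have : g a = Fin.elim0 := Subsingleton.elim _ _
    simp [ProtocolTree.run, this]
  | succ n ih =>
    obtain ⟨T₀, hd₀, h₀⟩ := ih (fun a => Fin.tail (g a)) (fun b k => h b (Fin.cons false k))
    obtain ⟨T₁, hd₁, h₁⟩ := ih (fun a => Fin.tail (g a)) (fun b k => h b (Fin.cons true k))
    refine ⟨.alice (fun a => g a 0) T₀ T₁, by simp [ProtocolTree.depth, hd₀, hd₁],
      fun a b => ?_⟩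
    rw [ProtocolTree.run, h₀, h₁]
    have := Fin.cons_self_tail (g a)
    cases hb : g a 0 <;> rw [hb] at this <;> simp [this]

/-- A number in `[-1, 1]` is nearly the expectation of the sign of a function of coins. -/
theorem exists_coin_function (N : ℕ) (w : ℝ) (hw : |w| ≤ 1) :
    ∃ s : (Fin N → Bool) → Bool, |(∑ r, boolSign (s r)) / 2 ^ N - w| ≤ 2 / 2 ^ N := by
  classical
  obtain ⟨hw₁, hw₂⟩ := abs_le.1 hw
  have hpos : (0 : ℝ) < 2 ^ N := by positivity
  have h0 : 0 ≤ (1 + w) / 2 * 2 ^ N := mul_nonneg (by linarith) hpos.le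
  -- A sign of mean `w` is `true` with probability `(1 + w) / 2`; `j` is the rounded number of coin
  -- strings on which this happens. Rounding by less than one string moves the mean by less than `2
  -- / 2 ^ N`.
  set j := ⌊(1 + w) / 2 * 2 ^ N⌋₊ with hj
  have hle : (j : ℝ) ≤ (1 + w) / 2 * 2 ^ N := Nat.floor_le h0
  have hlt : (1 + w) / 2 * 2 ^ N < j + 1 := Nat.lt_floor_add_one _
  have hj' : j ≤ (Finset.univ : Finset (Fin N → Bool)).card := by
    have : (j : ℝ) ≤ ((2 ^ N : ℕ) : ℝ) := by push_cast; nlinarith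
    simpa using (by exact_mod_cast this : j ≤ 2 ^ N)
  obtain ⟨S, -, hS⟩ := Finset.exists_subset_card_eq hj'
  refine ⟨fun r => decide (r ∈ S), ?_⟩
  have hsum : ∑ r : Fin N → Bool, boolSign (decide (r ∈ S)) = 2 * j - 2 ^ N := by
    have (r : Fin N → Bool) : boolSign (decide (r ∈ S)) = 2 * (if r ∈ S then 1 else 0) - 1 := by
      by_cases hr : r ∈ S <;> simp [hr]; norm_num
    simp [this, hS, mul_comm]
  rw [hsum, div_sub' hpos.ne', abs_div, abs_of_pos hpos]
  gcongr
  rw [abs_le]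
  constructor <;> linarith

theorem SignDecomposition.exists_randomizedProtocol {X Y : Type*} {f : X → Y → Bool}
    {m : ℕ} {δ : ℝ} (hδ : 0 < δ) (hf : SignDecomposition f m δ) :
    ∃ P : RandomizedProtocol X Y, P.comm = m + 2 ∧
      ∀ x y, P.outputProb x y (!f x y) ≤ 1 / 2 - δ / 2 ^ (m + 2) := by
  obtain ⟨u, v, hu, hv, h⟩ := hf
  -- Finitely many coins realize the means only approximately. Each of the `2 ^ m` products is off
  -- by at most `4 / 2 ^ N`, and `N` is chosen so that this uses up at most half of the margin.
  obtain ⟨N, hN⟩ : ∃ N : ℕ, 2 ^ m * 4 / (δ / 2) < (2 : ℝ) ^ N :=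
    pow_unbounded_of_one_lt _ one_lt_two
  have hN' : 2 ^ m * (4 / 2 ^ N) ≤ δ / 2 := by
    rw [div_lt_iff₀ (by positivity)] at hN
    rw [← mul_div_assoc, div_le_iff₀ (by positivity)]
    linarith
  choose s hs using fun x k => exists_coin_function N (u x k) (hu x k)
  choose t ht using fun y k => exists_coin_function N (v y k) (hv y k)
  -- The message is the random index followed by Alice's sign; the test `==` multiplies that sign by
  -- Bob's.
  obtain ⟨T, hd, hT⟩ := ProtocolTree.exists_oneWay (m + 1)
    (fun a : X × (Fin (m + N) → Bool) =>
      Fin.snoc (fun i => a.2 (Fin.castAdd N i))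
        (s a.1 (fun i => a.2 (Fin.castAdd N i)) fun i => a.2 (Fin.natAdd m i)) )
    (fun (b : Y × (Fin N → Bool)) k => k (Fin.last m) == t b.1 (Fin.init k) b.2)
  refine ⟨⟨m + N, N, T⟩, hd, fun x y => ?_⟩
  set u' : (Fin m → Bool) → ℝ := fun k => (∑ r, boolSign (s x k r)) / 2 ^ N with hu'
  set v' : (Fin m → Bool) → ℝ := fun k => (∑ r, boolSign (t y k r)) / 2 ^ N with hv'
  have hbias : RandomizedProtocol.bias ⟨m + N, N, T⟩ x y = (∑ k, u' k * v' k) / 2 ^ m := by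
    rw [RandomizedProtocol.bias, ← (Fin.appendEquiv m N).sum_comp, Fintype.sum_prod_type]
    simp only [hT, boolSign_beq, Fin.snoc_last, Fin.init_snoc, Fin.appendEquiv, Equiv.coe_fn_mk,
      Fin.append_left, Fin.append_right]
    simp only [hu', hv', div_mul_div_comm, Finset.sum_mul_sum, ← Finset.sum_div, div_div]
    congr 1
    ring
  have hdiff : |∑ k, u' k * v' k - ∑ k, u x k * v y k| ≤ δ / 2 := by
    refine le_trans ?_ hN'
    rw [← Finset.sum_sub_distrib]
    calc |∑ k, (u' k * v' k - u x k * v y k)| ≤ ∑ k, |u' k * v' k - u x k * v y k| :=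
          Finset.abs_sum_le_sum_abs _ _
      _ ≤ ∑ _k : Fin m → Bool, (4 / 2 ^ N : ℝ) := Finset.sum_le_sum fun k _ => ?_
      _ = 2 ^ m * (4 / 2 ^ N) := by simp
    have hv1 : |v' k| ≤ 1 :=
      abs_coin_average_le_one _ fun r => (abs_boolSign _).le
    calc |u' k * v' k - u x k * v y k|
        = |(u' k - u x k) * v' k + u x k * (v' k - v y k)| := by congr 1; ring
      _ ≤ |u' k - u x k| * |v' k| + |u x k| * |v' k - v y k| := by
          rw [← abs_mul, ← abs_mul]
          exact abs_add_le _ _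
      _ ≤ 2 / 2 ^ N * 1 + 1 * (2 / 2 ^ N) := by
          gcongr
          · exact hs x k
          · exact hu x k
          · exact ht y k
      _ = 4 / 2 ^ N := by ring
  rw [RandomizedProtocol.outputProb_not, hbias]
  have h1 := h x y
  have h2 : boolSign (f x y) * ∑ k, u x k * v y k - δ / 2 ≤
      boolSign (f x y) * ∑ k, u' k * v' k := by
    obtain ⟨h3, h4⟩ := abs_le.1 hdiff
    cases f x y <;> simp only [boolSign_true, boolSign_false] <;> linarith
  have h5 : δ / 2 / 2 ^ m ≤ boolSign (f x y) * ((∑ k, u' k * v' k) / 2 ^ m) := by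
    rw [← mul_div_assoc]
    gcongr
    linarith
  have h6 : δ / 2 ^ (m + 2) = δ / 2 / 2 ^ m / 2 := by
    rw [pow_add]; field_simp
  rw [h6]
  linarith


/-! ### From quantum protocols to sign decompositions -/

theorem Player.eq_other_of_ne {p q : Player} (h : ¬ q = p) : q = p.other := by
  cases p <;> cases q <;> simp_all [Player.other]

theorem Player.ne_other (p : Player) : p ≠ p.other := by
  cases p <;> simp [Player.other]

/-- A bit string is a pair of one on the qubits of `p` and one on those of the opponent. -/
def splitOwned {Q : Type} (own : Q → Player) (p : Player) :
    (Q → Bool) ≃ (Owned own p → Bool) × (Owned own p.other → Bool) where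
  toFun s := (fun i => s i.1, fun i => s i.1)
  invFun t i := if h : own i = p then t.1 ⟨i, h⟩ else t.2 ⟨i, Player.eq_other_of_ne h⟩
  left_inv s := by
    funext i
    by_cases h : own i = p <;> simp [h]
  right_inv t := by
    ext i
    · simp [i.2]
    · have : ¬ own i = p := fun h => p.ne_other (h.symm.trans i.2)
      simp [this]

theorem splitOwned_symm_apply_owned {Q : Type} (own : Q → Player) (p : Player)
    (t : (Owned own p → Bool) × (Owned own p.other → Bool)) (i : Owned own p) :
    (splitOwned own p).symm t i.1 = t.1 i :=
  congrFun (congrArg Prod.fst ((splitOwned own p).apply_symm_apply t)) i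

section Quantum

open Matrix ComplexConjugate

variable {Q : Type} [Fintype Q] [DecidableEq Q]

theorem applyLocal_eq_mulVec (own : Q → Player) (p : Player)
    (U : Matrix (Owned own p → Bool) (Owned own p → Bool) ℂ) (ψ : QState Q)
    (s : Q → Bool) :
    applyLocal own p U ψ s =
      (U *ᵥ fun t => ψ ((splitOwned own p).symm (t, (splitOwned own p s).2)))
        (splitOwned own p s).1 := by
  simp only [applyLocal, mulVec, dotProduct, splitOwned, Equiv.coe_fn_mk, Equiv.coe_fn_symm_mk]

theorem sum_norm_sq_mulVec {J : Type*} [Fintype J] [DecidableEq J] (U : unitaryGroup J ℂ)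
    (w : J → ℂ) : ∑ j, ‖(U.1 *ᵥ w) j‖ ^ 2 = ∑ j, ‖w j‖ ^ 2 := by
  have key (v : J → ℂ) : ((∑ j, ‖v j‖ ^ 2 : ℝ) : ℂ) = star v ⬝ᵥ v := by
    simp [dotProduct, Complex.conj_mul']
  have hU : U.1ᴴ * U.1 = 1 := Unitary.star_mul_self_of_mem U.2
  apply Complex.ofReal_injective
  rw [key, key, star_mulVec, ← dotProduct_mulVec, mulVec_mulVec, hU, one_mulVec]

theorem sum_norm_sq_applyLocal (own : Q → Player) (p : Player)
    (U : unitaryGroup (Owned own p → Bool) ℂ) (ψ : QState Q) :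
    ∑ s, ‖applyLocal own p U.1 ψ s‖ ^ 2 = ∑ s, ‖ψ s‖ ^ 2 := by
  rw [← (splitOwned own p).symm.sum_comp, ← (splitOwned own p).symm.sum_comp,
    Fintype.sum_prod_type_right, Fintype.sum_prod_type_right]
  refine Finset.sum_congr rfl fun t' _ => ?_
  simp only [applyLocal_eq_mulVec, Equiv.apply_symm_apply]
  exact sum_norm_sq_mulVec U _

namespace QRounds

/-- The expectation of the sign of the output. -/
noncomputable def bias {own : Q → Player} (R : QRounds Q own) (ψ : QState Q) : ℝ :=
  R.outputProb ψ true - R.outputProb ψ false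

theorem outputProb_true_add_false {own : Q → Player} (R : QRounds Q own) (ψ : QState Q) :
    R.outputProb ψ true + R.outputProb ψ false = ∑ s, ‖ψ s‖ ^ 2 := by
  induction R generalizing ψ with
  | finish own out =>
    simp only [outputProb]
    rw [← Finset.sum_add_distrib]
    refine Finset.sum_congr rfl fun s _ => ?_
    cases s out <;> simp
  | round own p U sent h rest ih =>
    simp only [outputProb]
    rw [ih, sum_norm_sq_applyLocal]

theorem outputProb_nonneg {own : Q → Player} (R : QRounds Q own) (ψ : QState Q) (b : Bool) :
    0 ≤ R.outputProb ψ b := by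
  induction R generalizing ψ with
  | finish own out =>
    simp only [outputProb]
    exact Finset.sum_nonneg fun s _ => by split_ifs <;> positivity
  | round own p U sent h rest ih => exact ih _

theorem outputProb_not {own : Q → Player} (R : QRounds Q own) {ψ : QState Q}
    (hψ : ∑ s, ‖ψ s‖ ^ 2 = 1) (b : Bool) :
    R.outputProb ψ (!b) = (1 - boolSign b * R.bias ψ) / 2 := by
  have := R.outputProb_true_add_false ψ
  rw [bias]
  cases b <;> simp <;> linarith

theorem bias_finish (own : Q → Player) (out : Q) (ψ : QState Q) :
    (finish own out).bias ψ = ∑ s, boolSign (s out) * ‖ψ s‖ ^ 2 := by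
  rw [bias, outputProb, outputProb, ← Finset.sum_sub_distrib]
  refine Finset.sum_congr rfl fun s _ => ?_
  cases s out <;> simp

end QRounds

/-- The states `ψ z z'` are sums of `n` products of a subnormalized state of the qubits of `p` that
depends on `z` and one of the qubits of the opponent that depends on `z'`. -/
def SplitState {Z Z' : Type*} (own : Q → Player) (p : Player) (n : ℕ)
    (ψ : Z → Z' → QState Q) : Prop :=
  ∃ (I : Type) (_ : Fintype I) (a : Z → I → (Owned own p → Bool) → ℂ)
    (b : Z' → I → (Owned own p.other → Bool) → ℂ),
    Fintype.card I = n ∧ (∀ z i, ∑ t, ‖a z i t‖ ^ 2 ≤ 1) ∧ (∀ z i, ∑ t, ‖b z i t‖ ^ 2 ≤ 1) ∧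
      ∀ z z' s, ψ z z' s = ∑ i, a z i (splitOwned own p s).1 * b z' i (splitOwned own p s).2

theorem SplitState.flip {Z Z' : Type*} {own : Q → Player} {p : Player} {n : ℕ}
    {ψ : Z → Z' → QState Q} (h : SplitState own p n ψ) :
    SplitState own p.other n (fun z' z => ψ z z') := by
  obtain ⟨I, _, a, b, hI, ha, hb, h⟩ := h
  -- For a concrete player `p.other.other` reduces to `p`, so the two factors can change places
  -- without a cast.
  cases p
  · exact ⟨I, _, b, a, hI, hb, ha, fun z z' s => (h z' z s).trans <|
      Finset.sum_congr rfl fun i _ => mul_comm _ _⟩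
  · exact ⟨I, _, b, a, hI, hb, ha, fun z z' s => (h z' z s).trans <|
      Finset.sum_congr rfl fun i _ => mul_comm _ _⟩

theorem SplitState.applyLocal {Z Z' : Type*} {own : Q → Player} {p : Player} {n : ℕ}
    {ψ : Z → Z' → QState Q} (h : SplitState own p n ψ)
    (U : unitaryGroup (Owned own p → Bool) ℂ) :
    SplitState own p n (fun z z' => applyLocal own p U.1 (ψ z z')) := by
  obtain ⟨I, _, a, b, hI, ha, hb, h⟩ := h
  refine ⟨I, _, fun z i => U.1 *ᵥ a z i, b, hI, fun z i => ?_, hb, fun z z' s => ?_⟩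
  · rw [sum_norm_sq_mulVec]
    exact ha z i
  · simp only [applyLocal_eq_mulVec, h, Equiv.apply_symm_apply, mulVec, dotProduct,
      Finset.mul_sum, Finset.sum_mul]
    rw [Finset.sum_comm]
    simp only [mul_assoc]

/-- Splitting each product according to the value of the sent qubit `q` fixes that value in the
sender's factor and moves the dependence on `q` into an indicator in the receiver's factor. The
pieces are only subnormalized, which is why `SplitState` asks for no more. -/
theorem SplitState.send {Z Z' : Type*} {own : Q → Player} {p : Player} {n : ℕ}
    {ψ : Z → Z' → QState Q} (h : SplitState own p n ψ) {q : Q} (hq : own q = p) :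
    SplitState (Function.update own q p.other) p (n * 2) ψ := by
  obtain ⟨I, _, a, b, hI, ha, hb, h⟩ := h
  set own' := Function.update own q p.other with hown
  have hq' : own' q = p.other := by simp [hown]
  have hA (i : Q) (hi : own i = p) (hne : i ≠ q) : own' i = p := by simp [hown, hne, hi]
  have hB (i : Q) (hi : own i = p.other) : own' i = p.other := by
    have : i ≠ q := by
      rintro rfl
      exact p.ne_other (hq.symm.trans hi)
    simp [hown, this, hi]
  have hA' (i : Q) (hi : own' i = p) : i ≠ q := by
    rintro rfl
    exact p.ne_other (hi.symm.trans hq')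
  have hA'' (i : Q) (hi : own' i = p) : own i = p := by
    have := hA' i hi
    simpa [hown, this] using hi
  have hB' (i : Q) (hi : own' i = p.other) (hne : i ≠ q) : own i = p.other := by
    simpa [hown, hne] using hi
  -- `extA` reinserts the value `v` at `q` for the old sender; `resB` forgets `q` for the old
  -- receiver.
  let extA (v : Bool) (t : Owned own' p → Bool) : Owned own p → Bool :=
    fun i => if h : i.1 = q then v else t ⟨i.1, hA i.1 i.2 h⟩
  let resB (t : Owned own' p.other → Bool) : Owned own p.other → Bool :=
    fun i => t ⟨i.1, hB i.1 i.2⟩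
  have hextA (v : Bool) : Function.Injective (extA v) := by
    intro t t' htt
    funext i
    have := congrFun htt ⟨i.1, hA'' i.1 i.2⟩
    simpa [extA, hA' i.1 i.2] using this
  have hresB (v : Bool) (t t' : Owned own' p.other → Bool) (ht : t ⟨q, hq'⟩ = v)
      (ht' : t' ⟨q, hq'⟩ = v) (htt : resB t = resB t') : t = t' := by
    funext ⟨i, hi⟩
    by_cases hne : i = q
    · subst hne
      rw [ht, ht']
    · exact congrFun htt ⟨i, hB' i hi hne⟩
  refine ⟨I × Bool, inferInstance, fun z i t => a z i.1 (extA i.2 t),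
    fun z i t => if t ⟨q, hq'⟩ = i.2 then b z i.1 (resB t) else 0, by simp [hI], ?_, ?_, ?_⟩
  · rintro z ⟨i, v⟩
    refine le_trans ?_ (ha z i)
    rw [← Finset.sum_image (f := fun t => ‖a z i t‖ ^ 2) (hextA v).injOn]
    exact Finset.sum_le_univ_sum_of_nonneg fun t => by positivity
  · rintro z ⟨i, v⟩
    refine le_trans ?_ (hb z i)
    have : ∑ t : Owned own' p.other → Bool,
        ‖if t ⟨q, hq'⟩ = v then b z i (resB t) else 0‖ ^ 2 =
        ∑ t with t ⟨q, hq'⟩ = v, ‖b z i (resB t)‖ ^ 2 := by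
      rw [Finset.sum_filter]
      refine Finset.sum_congr rfl fun t _ => ?_
      split_ifs <;> simp
    rw [this, ← Finset.sum_image (f := fun t => ‖b z i t‖ ^ 2)]
    · exact Finset.sum_le_univ_sum_of_nonneg fun t => by positivity
    · intro t ht t' ht' htt
      exact hresB v t t' (by simpa using ht) (by simpa using ht') htt
  · intro z z' s
    have h1 : extA (s q) (splitOwned own' p s).1 = (splitOwned own p s).1 := by
      funext ⟨i, hi⟩
      by_cases hne : i = q
      · subst hne
        simp [extA, splitOwned]
      · simp [extA, splitOwned, hne]
    have h2 : resB (splitOwned own' p s).2 = (splitOwned own p s).2 := rfl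
    have h3 : (splitOwned own' p s).2 ⟨q, hq'⟩ = s q := rfl
    rw [h, Fintype.sum_prod_type]
    refine Finset.sum_congr rfl fun i _ => ?_
    simp only [h3, mul_ite, mul_zero, Finset.sum_ite_eq, Finset.mem_univ, if_true, h1, h2]

/-- The function `F` is a sum of `n` products of functions of one argument bounded by `1`. -/
def BilinearSum {Z Z' : Type*} (n : ℕ) (F : Z → Z' → ℝ) : Prop :=
  ∃ (K : Type) (_ : Fintype K) (u : Z → K → ℝ) (v : Z' → K → ℝ), Fintype.card K = n ∧
    (∀ z k, |u z k| ≤ 1) ∧ (∀ z k, |v z k| ≤ 1) ∧ ∀ z z', F z z' = ∑ k, u z k * v z' k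

theorem BilinearSum.flip {Z Z' : Type*} {n : ℕ} {F : Z → Z' → ℝ} (h : BilinearSum n F) :
    BilinearSum n (fun z' z => F z z') := by
  obtain ⟨K, _, u, v, hK, hu, hv, h⟩ := h
  exact ⟨K, _, v, u, hK, hv, hu, fun z z' => (h z' z).trans <|
    Finset.sum_congr rfl fun i _ => mul_comm _ _⟩

theorem norm_sum_sign_mul_conj_le_one {J : Type*} [Fintype J] (σ : J → ℝ) (hσ : ∀ j, |σ j| ≤ 1)
    (a b : J → ℂ) (ha : ∑ j, ‖a j‖ ^ 2 ≤ 1) (hb : ∑ j, ‖b j‖ ^ 2 ≤ 1) :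
    ‖∑ j, (σ j : ℂ) * (a j * conj (b j))‖ ≤ 1 := by
  calc ‖∑ j, (σ j : ℂ) * (a j * conj (b j))‖ ≤ ∑ j, ‖(σ j : ℂ) * (a j * conj (b j))‖ :=
        norm_sum_le _ _
    _ ≤ ∑ j, (‖a j‖ ^ 2 + ‖b j‖ ^ 2) / 2 := Finset.sum_le_sum fun j _ => ?_
    _ ≤ 1 := by
      rw [← Finset.sum_div, Finset.sum_add_distrib]
      linarith
  rw [norm_mul, norm_mul, Complex.norm_real, Complex.norm_conj, Real.norm_eq_abs]
  have h1 : ‖a j‖ * ‖b j‖ ≤ (‖a j‖ ^ 2 + ‖b j‖ ^ 2) / 2 := by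
    linarith [sq_nonneg (‖a j‖ - ‖b j‖)]
  have h2 : 0 ≤ ‖a j‖ * ‖b j‖ := by positivity
  nlinarith [hσ j, abs_nonneg (σ j)]

/-- Expanding `‖∑ i, a i * b i‖ ^ 2` gives `n ^ 2` pairs, and the sign of the measured qubit
involves only the factor of its owner. Each pair contributes a complex product, whose real part is
two real products; hence the factor `2`. -/
theorem SplitState.bilinearSum_finish {Z Z' : Type*} {own : Q → Player} {p : Player} {n : ℕ}
    {ψ : Z → Z' → QState Q} (h : SplitState own p n ψ) {out : Q} (hout : own out = p) :
    BilinearSum (2 * n ^ 2) (fun z z' => (QRounds.finish own out).bias (ψ z z')) := by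
  obtain ⟨I, _, a, b, hI, ha, hb, h⟩ := h
  let α (z : Z) (i j : I) : ℂ :=
    ∑ t, (boolSign (t ⟨out, hout⟩) : ℂ) * (a z i t * conj (a z j t))
  let β (z : Z') (i j : I) : ℂ := ∑ t, ((1 : ℝ) : ℂ) * (b z i t * conj (b z j t))
  have hα (z i j) : ‖α z i j‖ ≤ 1 :=
    norm_sum_sign_mul_conj_le_one _ (fun _ => (abs_boolSign _).le) _ _ (ha z i) (ha z j)
  have hβ (z i j) : ‖β z i j‖ ≤ 1 :=
    norm_sum_sign_mul_conj_le_one _ (by simp) _ _ (hb z i) (hb z j)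
  have key (z : Z) (z' : Z') : (((QRounds.finish own out).bias (ψ z z') : ℝ) : ℂ) =
      ∑ i, ∑ j, α z i j * β z' i j := by
    have h1 (t t') : ψ z z' ((splitOwned own p).symm (t, t')) = ∑ i, a z i t * b z' i t' := by
      simp [h]
    have h2 (t t') : (splitOwned own p).symm (t, t') out = t ⟨out, hout⟩ :=
      splitOwned_symm_apply_owned own p (t, t') ⟨out, hout⟩
    have h3 (t t') : (‖∑ i, a z i t * b z' i t'‖ ^ 2 : ℂ) =
        ∑ i, ∑ j, a z i t * conj (a z j t) * (b z' i t' * conj (b z' j t')) := by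
      rw [← Complex.mul_conj', map_sum, Finset.sum_mul_sum]
      refine Finset.sum_congr rfl fun i _ => Finset.sum_congr rfl fun j _ => ?_
      rw [map_mul]
      ring
    rw [QRounds.bias_finish, ← (splitOwned own p).symm.sum_comp, Fintype.sum_prod_type]
    push_cast
    have h4 (i j) : α z i j * β z' i j = ∑ t, ∑ t', (boolSign (t ⟨out, hout⟩) : ℂ) *
        (a z i t * conj (a z j t) * (b z' i t' * conj (b z' j t'))) := by
      simp only [α, β, Finset.sum_mul_sum, Complex.ofReal_one, one_mul, mul_assoc]
    simp only [h1, h2, h3, h4, Finset.mul_sum]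
    calc ∑ t, ∑ t', ∑ i, ∑ j, (boolSign (t ⟨out, hout⟩) : ℂ) *
          (a z i t * conj (a z j t) * (b z' i t' * conj (b z' j t')))
        = ∑ t, ∑ i, ∑ t', ∑ j, (boolSign (t ⟨out, hout⟩) : ℂ) *
          (a z i t * conj (a z j t) * (b z' i t' * conj (b z' j t'))) :=
          Finset.sum_congr rfl fun t _ => Finset.sum_comm
      _ = ∑ i, ∑ t, ∑ t', ∑ j, (boolSign (t ⟨out, hout⟩) : ℂ) *
          (a z i t * conj (a z j t) * (b z' i t' * conj (b z' j t'))) := Finset.sum_comm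
      _ = ∑ i, ∑ t, ∑ j, ∑ t', (boolSign (t ⟨out, hout⟩) : ℂ) *
          (a z i t * conj (a z j t) * (b z' i t' * conj (b z' j t'))) :=
          Finset.sum_congr rfl fun i _ => Finset.sum_congr rfl fun t _ => Finset.sum_comm
      _ = ∑ i, ∑ j, ∑ t, ∑ t', (boolSign (t ⟨out, hout⟩) : ℂ) *
          (a z i t * conj (a z j t) * (b z' i t' * conj (b z' j t'))) :=
          Finset.sum_congr rfl fun i _ => Finset.sum_comm
  -- The Boolean selects the real or the imaginary parts; the minus sign is that of `re * re - im *
  -- im`.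
  refine ⟨I × I × Bool, inferInstance,
    fun z k => if k.2.2 then (α z k.1 k.2.1).re else (α z k.1 k.2.1).im,
    fun z k => if k.2.2 then (β z k.1 k.2.1).re else -(β z k.1 k.2.1).im, ?_, ?_, ?_, ?_⟩
  · simp [hI]
    ring
  · intro z k
    dsimp only
    split_ifs
    · exact (Complex.abs_re_le_norm _).trans (hα _ _ _)
    · exact (Complex.abs_im_le_norm _).trans (hα _ _ _)
  · intro z k
    dsimp only
    split_ifs
    · exact (Complex.abs_re_le_norm _).trans (hβ _ _ _)
    · rw [abs_neg]
      exact (Complex.abs_im_le_norm _).trans (hβ _ _ _)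
  · intro z z'
    have := congrArg Complex.re (key z z')
    rw [Complex.ofReal_re] at this
    dsimp only
    rw [this]
    simp only [Complex.re_sum, Complex.mul_re, Fintype.sum_prod_type, Fintype.sum_bool, if_true]
    simp [sub_eq_add_neg]

/-- Every round doubles the number of terms. The invariant is kept from Alice's side; Bob's rounds
and Bob's output qubit are handled by `flip`. -/
theorem SplitState.bilinearSum {Z Z' : Type*} {own : Q → Player} (R : QRounds Q own) {n : ℕ}
    {ψ : Z → Z' → QState Q} (h : SplitState own .alice n ψ) :
    BilinearSum (2 * (n * 2 ^ R.length) ^ 2) (fun z z' => R.bias (ψ z z')) := by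
  induction R generalizing n ψ with
  | finish own out =>
    rw [QRounds.length, pow_zero, mul_one]
    rcases hp : own out with _ | _
    · exact h.bilinearSum_finish hp
    · exact (h.flip.bilinearSum_finish hp).flip
  | round own p U sent hs rest ih =>
    have key : SplitState (Function.update own sent p.other) .alice (n * 2)
        (fun z z' => CommComplexity.applyLocal own p U.1 (ψ z z')) := by
      cases p
      · exact (h.applyLocal U).send hs
      · exact ((h.flip.applyLocal U).send hs).flip
    have := ih key
    rw [mul_assoc, ← pow_succ'] at this
    exact this

theorem sum_norm_sq_basisState (s : Q → Bool) :
    ∑ t, ‖basisState s t‖ ^ 2 = 1 := by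
  have (t : Q → Bool) : ‖basisState s t‖ ^ 2 = if t = s then 1 else 0 := by
    rw [basisState]
    split_ifs <;> simp
  simp [this]

end Quantum

namespace QuantumProtocol

variable {X Y : Type*}

/-- This is where the absence of prior entanglement enters: the initial state is a single product.
-/
theorem splitState_initialState (P : QuantumProtocol X Y) :
    SplitState (initialOwner P.nA P.wA P.nB P.wB) .alice 1 P.initialState := by
  let a (x : X) : Owned (initialOwner P.nA P.wA P.nB P.wB) .alice → Bool :=
    fun i => Sum.elim (Sum.elim (P.encA x) fun _ => false) (fun _ => false) i.1
  let b (y : Y) : Owned (initialOwner P.nA P.wA P.nB P.wB) Player.alice.other → Bool :=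
    fun i => Sum.elim (fun _ => false) (Sum.elim (P.encB y) fun _ => false) i.1
  refine ⟨Unit, inferInstance, fun x _ => basisState (a x), fun y _ => basisState (b y), by simp,
    fun x _ => (sum_norm_sq_basisState _).le, fun x _ => (sum_norm_sq_basisState _).le,
    fun x y s => ?_⟩
  have hiff : s = Sum.elim (Sum.elim (P.encA x) fun _ => false)
      (Sum.elim (P.encB y) fun _ => false) ↔
      (splitOwned (initialOwner P.nA P.wA P.nB P.wB) .alice s).1 = a x ∧
      (splitOwned (initialOwner P.nA P.wA P.nB P.wB) .alice s).2 = b y := by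
    constructor
    · rintro rfl
      constructor
      · funext ⟨i, hi⟩
        rcases i with i | i
        · rfl
        · exact absurd hi (by simp [initialOwner])
      · funext ⟨i, hi⟩
        rcases i with i | i
        · exact absurd hi (by simp [initialOwner, Player.other])
        · rfl
    · rintro ⟨h1, h2⟩
      funext i
      rcases i with i | i
      · exact congrFun h1 ⟨Sum.inl i, rfl⟩
      · exact congrFun h2 ⟨Sum.inr i, rfl⟩
  simp only [initialState, basisState, Finset.univ_unique, Finset.sum_singleton, hiff,
    mul_ite, mul_one, mul_zero, ← ite_and]
  simp only [and_comm]

theorem outputProb_le_error [Finite X] [Finite Y] (P : QuantumProtocol X Y)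
    (f : X → Y → Bool) (x : X) (y : Y) : P.outputProb x y (!f x y) ≤ P.error f :=
  le_ciSup (f := fun p : X × Y => P.outputProb p.1 p.2 (!f p.1 p.2))
    (Set.finite_range _).bddAbove (x, y)

theorem error_nonneg (P : QuantumProtocol X Y) (f : X → Y → Bool) : 0 ≤ P.error f :=
  Real.iSup_nonneg fun _ => P.rounds.outputProb_nonneg _ _

theorem signDecomposition [Finite X] [Finite Y] (P : QuantumProtocol X Y) (f : X → Y → Bool)
    (h : P.error f < 1 / 2) : SignDecomposition f (2 * P.comm + 1) (1 / 2 - P.error f) := by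
  obtain ⟨K, _, u, v, hK, hu, hv, hF⟩ := SplitState.bilinearSum P.rounds P.splitState_initialState
  refine .of_fintype (le_of_eq ?_) u v hu hv fun x y => ?_
  · rw [hK, comm]
    ring
  · rw [← hF]
    have h1 := P.outputProb_le_error f x y
    have h2 : ∑ s, ‖P.initialState x y s‖ ^ 2 = 1 := sum_norm_sq_basisState _
    rw [outputProb, QRounds.outputProb_not _ h2] at h1
    dsimp only
    linarith

end QuantumProtocol


/-! ### From sign decompositions to quantum protocols -/

section Quantum

open Matrix

/-- There is a unitary matrix with prescribed columns of disjoint supports. -/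
theorem exists_unitary_apply_eq {J K M : Type*} [Fintype J] [DecidableEq J] [Fintype M]
    (s : K → M → J) (hs : Function.Injective2 s) (φ : K → M → ℂ)
    (hφ : ∀ k, ∑ m, ‖φ k m‖ ^ 2 = 1) (m₀ : M) :
    ∃ U : unitaryGroup J ℂ, ∀ k j, U.1 j (s k m₀) = ∑ m, if j = s k m then φ k m else 0 := by
  classical
  let w (k : K) : EuclideanSpace ℂ J :=
    WithLp.toLp 2 fun j => ∑ m, if j = s k m then φ k m else 0
  have hw : Orthonormal ℂ w := by
    rw [orthonormal_iff_ite]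
    intro k k'
    have h1 : inner ℂ (w k) (w k') = ∑ j, (∑ m', if j = s k' m' then φ k' m' else 0) *
        star (∑ m, if j = s k m then φ k m else 0) := by
      simp [w, PiLp.inner_apply]
    have h2 : inner ℂ (w k) (w k') =
        ∑ m', ∑ m, if s k m = s k' m' then φ k' m' * star (φ k m) else 0 := by
      rw [h1]
      simp only [star_sum, Finset.sum_mul_sum]
      rw [Finset.sum_comm]
      refine Finset.sum_congr rfl fun m' _ => ?_
      rw [Finset.sum_comm]
      refine Finset.sum_congr rfl fun m _ => ?_
      simp only [ite_mul, zero_mul, Finset.sum_ite_eq', Finset.mem_univ, if_true]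
      rw [apply_ite star, star_zero, mul_ite, mul_zero]
      simp only [eq_comm]
    rw [h2]
    split_ifs with hk
    · subst hk
      have (m m' : M) : s k m = s k m' ↔ m = m' := ⟨fun h => (hs h).2, fun h => h ▸ rfl⟩
      simp only [this, Finset.sum_ite_eq', Finset.mem_univ, if_true]
      have h3 (m : M) : φ k m * star (φ k m) = ((‖φ k m‖ ^ 2 : ℝ) : ℂ) := by
        simp [Complex.mul_conj']
      simp only [h3, ← Complex.ofReal_sum, hφ, Complex.ofReal_one]
    · refine Finset.sum_eq_zero fun m' _ => Finset.sum_eq_zero fun m _ => ?_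
      rw [if_neg fun h => hk (hs h).1]
  have hinj : Function.Injective fun k => s k m₀ := fun k k' h => (hs h).1
  -- The default `0` is harmless: only the prescribed columns are kept when the family is completed
  -- to an orthonormal basis.
  let v : J → EuclideanSpace ℂ J := Function.extend (fun k => s k m₀) w 0
  have hv (k : K) : v (s k m₀) = w k := hinj.extend_apply w 0 k
  have hvo : Orthonormal ℂ ((Set.range fun k => s k m₀).domRestrict v) := by
    have : (Set.range fun k => s k m₀).domRestrict v = w ∘ (Equiv.ofInjective _ hinj).symm := by
      funext ⟨_, k, rfl⟩
      have : (Equiv.ofInjective _ hinj).symm ⟨s k m₀, k, rfl⟩ = k :=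
        Equiv.ofInjective_symm_apply hinj k
      rw [Function.comp_apply, this]
      exact hv k
    rw [this]
    exact hw.comp _ (Equiv.injective _)
  obtain ⟨b, hb⟩ := hvo.exists_orthonormalBasis_extension_of_card_eq (by simp)
  refine ⟨⟨(EuclideanSpace.basisFun J ℂ).toBasis.toMatrix b,
    (EuclideanSpace.basisFun J ℂ).toMatrix_orthonormalBasis_mem_unitary b⟩, fun k j => ?_⟩
  simp [Module.Basis.toMatrix_apply, hb _ ⟨k, rfl⟩, hv, w]

variable {Q : Type} [Fintype Q] [DecidableEq Q]

theorem applyLocal_one (own : Q → Player) (p : Player) (ψ : QState Q) :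
    applyLocal own p 1 ψ = ψ := by
  funext s
  rw [applyLocal_eq_mulVec, one_mulVec]
  simp

theorem applyLocal_sum_smul {I : Type*} (S : Finset I) (own : Q → Player) (p : Player)
    (U : Matrix (Owned own p → Bool) (Owned own p → Bool) ℂ) (c : I → ℂ) (ψ : I → QState Q) :
    applyLocal own p U (∑ i ∈ S, c i • ψ i) = ∑ i ∈ S, c i • applyLocal own p U (ψ i) := by
  funext s
  simp only [applyLocal, Finset.sum_apply, Pi.smul_apply, smul_eq_mul, Finset.mul_sum]
  rw [Finset.sum_comm]
  simp only [mul_left_comm]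

/-- A player can prepare a superposition that is controlled by a part of his qubits. -/
theorem exists_unitary_applyLocal_basisState {K M : Type*} [Fintype M] (own : Q → Player)
    (p : Player) (s : K → M → Owned own p → Bool) (hs : Function.Injective2 s) (φ : K → M → ℂ)
    (hφ : ∀ k, ∑ m, ‖φ k m‖ ^ 2 = 1) (m₀ : M) :
    ∃ U : unitaryGroup (Owned own p → Bool) ℂ, ∀ k t,
      applyLocal own p U.1 (basisState ((splitOwned own p).symm (s k m₀, t))) =
        ∑ m, φ k m • basisState ((splitOwned own p).symm (s k m, t)) := by
  obtain ⟨U, hU⟩ := exists_unitary_apply_eq s hs φ hφ m₀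
  refine ⟨U, fun k t => ?_⟩
  funext r
  obtain ⟨⟨r₁, r₂⟩, rfl⟩ := (splitOwned own p).symm.surjective r
  simp only [applyLocal_eq_mulVec, Equiv.apply_symm_apply, mulVec, dotProduct, mul_ite,
    mul_one, mul_zero, Finset.sum_apply,
    Pi.smul_apply, smul_eq_mul, basisState, EmbeddingLike.apply_eq_iff_eq, Prod.mk.injEq]
  by_cases h : r₂ = t <;> simp [h, hU]

namespace QRounds

theorem outputProb_finish_sum_basisState {I : Type*} [Fintype I] (own : Q → Player) (out : Q)
    (c : I → ℂ) (g : I → Q → Bool) (hg : Function.Injective g) (b : Bool) :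
    (finish own out).outputProb (∑ i, c i • basisState (g i)) b =
      ∑ i, if g i out = b then ‖c i‖ ^ 2 else 0 := by
  classical
  symm
  apply Finset.sum_of_injOn g hg.injOn (by simp)
  · intro s _ hs
    have hs' : ∀ i, ¬ s = g i := fun i hi => hs ⟨i, by simp, hi.symm⟩
    simp [basisState, hs']
  · intro i _
    simp [basisState, hg.eq_iff]

/-- Alice can send several qubits without changing the state. -/
theorem exists_send_list (l : List Q) (hl : l.Nodup) (own own' : Q → Player)
    (h : ∀ i ∈ l, own i = .alice) (h' : ∀ i, own' i = if i ∈ l then .bob else own i)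
    (rest : QRounds Q own') :
    ∃ R : QRounds Q own, R.length = l.length + rest.length ∧
      ∀ ψ b, R.outputProb ψ b = rest.outputProb ψ b := by
  induction l generalizing own with
  | nil =>
    obtain rfl : own' = own := funext fun i => by simp [h']
    exact ⟨rest, by simp, fun _ _ => rfl⟩
  | cons q l ih =>
    rw [List.nodup_cons] at hl
    obtain ⟨R, hR, hR'⟩ := ih hl.2 (Function.update own q .bob)
      (fun i hi => by
        have : i ≠ q := fun e => hl.1 (e ▸ hi)
        rw [Function.update_of_ne this]
        exact h i (List.mem_cons_of_mem _ hi))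
      (fun i => by
        rw [h']
        by_cases hi : i = q
        · subst hi
          simp
        · simp [hi])
    refine ⟨round own .alice 1 q (h q List.mem_cons_self) R, ?_, fun ψ b => ?_⟩
    · change R.length + 1 = (l.length + 1) + rest.length
      omega
    · exact (hR' _ b).trans (congrArg (rest.outputProb · b) (applyLocal_one own .alice ψ))

end QRounds

end Quantum

theorem exists_injective_bits (Z : Type*) [Finite Z] :
    ∃ (m : ℕ) (e : Z → Fin m → Bool), Function.Injective e := by
  have := Fintype.ofFinite Z
  obtain ⟨e⟩ : Nonempty (Z ↪ (Fin (Fintype.card Z) → Bool)) :=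
    Function.Embedding.nonempty_of_card_le (by simpa using Nat.lt_two_pow_self.le)
  exact ⟨_, e, e.injective⟩

/-- A quantum protocol can simulate a randomized one-way protocol in which Alice sends a message
with a distribution `p x` and Bob answers with a distribution that depends on his input and the
message. -/
theorem exists_quantumProtocol_oneWay {X Y : Type*} [Finite X] [Finite Y] (n : ℕ)
    (p : X → (Fin (n + 1) → Bool) → ℝ) (q : Y → (Fin (n + 1) → Bool) → Bool → ℝ)
    (hp₀ : ∀ x k, 0 ≤ p x k) (hp₁ : ∀ x, ∑ k, p x k = 1)
    (hq₀ : ∀ y k b, 0 ≤ q y k b) (hq₁ : ∀ y k, ∑ b, q y k b = 1) :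
    ∃ P : QuantumProtocol X Y, P.comm = n + 2 ∧
      ∀ x y b, P.outputProb x y b = ∑ k, p x k * q y k b := by
  classical
  obtain ⟨nA, eA, hA⟩ := exists_injective_bits X
  obtain ⟨nB, eB, hB⟩ := exists_injective_bits Y
  let own₀ := initialOwner nA (n + 1) nB 1
  -- The possession after Alice has sent all her work qubits.
  let own₂ : Qubits nA (n + 1) nB 1 → Player :=
    Sum.elim (Sum.elim (fun _ => .alice) (fun _ => .bob)) (fun _ => .bob)
  let G (x : X) (y : Y) (k : Fin (n + 1) → Bool) (b : Bool) : Qubits nA (n + 1) nB 1 → Bool :=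
    Sum.elim (Sum.elim (eA x) k) (Sum.elim (eB y) fun _ => b)
  let sA (x : X) (k : Fin (n + 1) → Bool) : Owned own₀ .alice → Bool :=
    fun i => Sum.elim (Sum.elim (eA x) k) (fun _ => false) i.1
  let tA (y : Y) : Owned own₀ Player.alice.other → Bool :=
    fun i => Sum.elim (fun _ => false) (Sum.elim (eB y) fun _ => false) i.1
  let sB (z : Y × (Fin (n + 1) → Bool)) (b : Bool) : Owned own₂ .bob → Bool :=
    fun i => Sum.elim (Sum.elim (fun _ => false) z.2) (Sum.elim (eB z.1) fun _ => b) i.1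
  let tB (x : X) : Owned own₂ Player.bob.other → Bool :=
    fun i => Sum.elim (Sum.elim (eA x) fun _ => false) (fun _ => false) i.1
  have hGA (x y k) : (splitOwned own₀ .alice).symm (sA x k, tA y) = G x y k false := by
    rw [Equiv.symm_apply_eq]
    refine Prod.ext ?_ ?_
    · funext ⟨i, hi⟩
      rcases i with (i | i) | (i | i)
      exacts [rfl, rfl, absurd hi (by simp [own₀, initialOwner]),
        absurd hi (by simp [own₀, initialOwner])]
    · funext ⟨i, hi⟩
      rcases i with (i | i) | (i | i)
      exacts [absurd hi (by simp [own₀, initialOwner, Player.other]),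
        absurd hi (by simp [own₀, initialOwner, Player.other]), rfl, rfl]
  have hGB (x y k b) : (splitOwned own₂ .bob).symm (sB (y, k) b, tB x) = G x y k b := by
    rw [Equiv.symm_apply_eq]
    refine Prod.ext ?_ ?_
    · funext ⟨i, hi⟩
      rcases i with (i | i) | (i | i)
      exacts [absurd hi (by simp [own₂]), rfl, rfl, rfl]
    · funext ⟨i, hi⟩
      rcases i with (i | i) | (i | i)
      exacts [rfl, absurd hi (by simp [own₂, Player.other]),
        absurd hi (by simp [own₂, Player.other]), absurd hi (by simp [own₂, Player.other])]
  have hsA : Function.Injective2 sA := fun x x' k k' h =>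
    ⟨hA (funext fun i => congrFun h ⟨.inl (.inl i), rfl⟩),
      funext fun i => congrFun h ⟨.inl (.inr i), rfl⟩⟩
  have hsB : Function.Injective2 sB := fun z z' b b' h =>
    ⟨Prod.ext (hB (funext fun i => congrFun h ⟨.inr (.inl i), rfl⟩))
      (funext fun i => congrFun h ⟨.inl (.inr i), rfl⟩), congrFun h ⟨.inr (.inr 0), rfl⟩⟩
  have hsqrt {r : ℝ} (hr : 0 ≤ r) : ‖((√r : ℝ) : ℂ)‖ ^ 2 = r := by
    rw [Complex.norm_real, Real.norm_eq_abs, sq_abs, Real.sq_sqrt hr]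
  obtain ⟨U, hU⟩ := exists_unitary_applyLocal_basisState own₀ .alice sA hsA
    (fun x k => ((√(p x k) : ℝ) : ℂ)) (fun x => by simp only [hsqrt (hp₀ _ _), hp₁])
    (fun _ => false)
  obtain ⟨V, hV⟩ := exists_unitary_applyLocal_basisState own₂ .bob sB hsB
    (fun z b => ((√(q z.1 z.2 b) : ℝ) : ℂ)) (fun z => by simp only [hsqrt (hq₀ _ _ _), hq₁])
    false
  -- Alice's first work qubit leaves in the round that applies `U`, so `n` remain to be sent. Bob's
  -- round must also send a qubit, and he sends the output qubit.
  obtain ⟨R, hR, hR'⟩ := QRounds.exists_send_list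
    ((List.finRange n).map fun i => (.inl (.inr i.succ) : Qubits nA (n + 1) nB 1))
    ((List.nodup_finRange n).map fun i j h => by simpa using h)
    (Function.update own₀ (.inl (.inr 0)) .bob) own₂
    (fun i hi => by
      obtain ⟨j, -, rfl⟩ := List.mem_map.1 hi
      rw [Function.update_of_ne (by simp [Fin.succ_ne_zero])]
      rfl)
    (fun i => by
      rcases i with (i | i) | (i | i)
      · simp [own₂, own₀, initialOwner]
      · rcases Fin.eq_zero_or_eq_succ i with rfl | ⟨j, rfl⟩
        · simp [own₂]
        · simp [own₂]
      · simp [own₂, own₀, initialOwner]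
      · simp [own₂, own₀, initialOwner])
    (.round own₂ .bob V (.inr (.inr 0)) rfl (.finish _ (.inr (.inr 0))))
  refine ⟨⟨nA, n + 1, nB, 1, eA, hA, eB, hB, .round own₀ .alice U (.inl (.inr 0)) rfl R⟩, ?_,
    fun x y b => ?_⟩
  · change R.length + 1 = n + 2
    rw [hR]
    simp [QRounds.length]
  · change R.outputProb (applyLocal own₀ .alice U.1 (basisState (G x y (fun _ => false) false))) b
      = _
    rw [hR', ← hGA, hU]
    change (QRounds.finish _ _).outputProb (applyLocal own₂ .bob V.1 _) b = _
    rw [applyLocal_sum_smul]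
    simp only [hGA]
    simp only [← hGB, hV]
    simp only [hGB, Finset.smul_sum, smul_smul]
    rw [← Fintype.sum_prod_type' (f := fun k b =>
      (((√(p x k) : ℝ) : ℂ) * ((√(q y k b) : ℝ) : ℂ)) • basisState (G x y k b)),
      QRounds.outputProb_finish_sum_basisState, Fintype.sum_prod_type]
    · refine Finset.sum_congr rfl fun k _ => ?_
      simp [G, mul_pow, hp₀, hq₀]
    -- Distinct pairs `(k, b)` end in distinct basis states, so nothing interferes and the
    -- probabilities are the classical ones.
    · rintro ⟨k, b⟩ ⟨k', b'⟩ h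
      exact Prod.ext (funext fun i => congrFun h (.inl (.inr i))) (congrFun h (.inr (.inr 0)))

/-- The bit `k 0` of the message is Alice's sign and the tail is the index. Amplitudes are
arbitrary, so no rounding is needed and the margin is twice the classical one. -/
theorem SignDecomposition.exists_quantumProtocol {X Y : Type*} [Finite X] [Finite Y]
    {f : X → Y → Bool} {m : ℕ} {δ : ℝ} (hf : SignDecomposition f m δ) :
    ∃ P : QuantumProtocol X Y, P.comm = m + 2 ∧
      ∀ x y, P.outputProb x y (!f x y) ≤ 1 / 2 - δ / 2 ^ (m + 1) := by
  obtain ⟨u, v, hu, hv, h⟩ := hf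
  have hpos {b : Bool} {w : ℝ} (hw : |w| ≤ 1) : 0 ≤ (1 + boolSign b * w) / 2 := by
    obtain ⟨h1, h2⟩ := abs_le.1 hw
    cases b <;> simp <;> linarith
  have hcons (g : (Fin (m + 1) → Bool) → ℝ) : ∑ k, g k = ∑ b, ∑ k, g (Fin.cons b k) := by
    rw [← (Fin.consEquiv fun _ => Bool).sum_comp, Fintype.sum_prod_type]
    rfl
  obtain ⟨P, hP, hP'⟩ := exists_quantumProtocol_oneWay (X := X) (Y := Y) m
    (fun x k => (1 + boolSign (k 0) * u x (Fin.tail k)) / 2 / 2 ^ m)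
    (fun y k b => (1 + boolSign b * (boolSign (k 0) * v y (Fin.tail k))) / 2)
    (fun x k => div_nonneg (hpos (hu _ _)) (by positivity))
    (fun x => by
      rw [hcons, Finset.sum_comm]
      have (r : ℝ) : (1 + r) / 2 / 2 ^ m + (1 + -r) / 2 / 2 ^ m = 1 / 2 ^ m := by ring
      simp [this])
    (fun y k b => hpos (by rw [abs_mul, abs_boolSign, one_mul]; exact hv _ _))
    (fun y k => by simp; ring)
  refine ⟨P, hP, fun x y => ?_⟩
  rw [hP', hcons, Finset.sum_comm]
  have h1 (k : Fin m → Bool) : ∑ b, (1 + boolSign b * u x k) / 2 / 2 ^ m *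
      ((1 + boolSign (!f x y) * (boolSign b * v y k)) / 2) =
      1 / 2 ^ (m + 1) - boolSign (f x y) * (u x k * v y k) / 2 ^ (m + 1) := by
    cases f x y <;> simp <;> ring
  simp only [Fin.cons_zero, Fin.tail_cons, h1]
  have h2 : ∑ _k : Fin m → Bool, (1 : ℝ) / 2 ^ (m + 1) = 1 / 2 := by
    simp [pow_succ]
    field_simp
  rw [Finset.sum_sub_distrib, h2, ← Finset.sum_div, ← Finset.mul_sum]
  gcongr
  exact h x y


/-! ### Comparison of the costs -/

/-- The advantage is at most `1 / 2`, so its logarithm has a negative floor. In particular costs are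
at least `1`, which later absorbs additive constants. -/
theorem comm_lt_weaklyUnboundedCost (c : ℕ) {err : ℝ} (h₀ : 0 ≤ err) (h : err < 1 / 2) :
    (c : ℤ) + 1 ≤ weaklyUnboundedCost c err := by
  have h1 : Real.logb 2 (1 / 2 - err) < 0 :=
    Real.logb_neg one_lt_two (by linarith) (by linarith)
  have h2 : ⌊Real.logb 2 (1 / 2 - err)⌋ < 0 := Int.floor_lt.2 (by simpa using h1)
  rw [weaklyUnboundedCost]
  omega

theorem weaklyUnboundedCost_le {c m : ℕ} {err δ : ℝ} (hδ : 0 < δ)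
    (h : err ≤ 1 / 2 - δ / 2 ^ m) : weaklyUnboundedCost c err ≤ c + m - ⌊Real.logb 2 δ⌋ := by
  have hm : (0 : ℝ) < 2 ^ m := by positivity
  have h1 : Real.logb 2 δ - m ≤ Real.logb 2 (1 / 2 - err) := by
    calc Real.logb 2 δ - m = Real.logb 2 (δ / 2 ^ m) := by
          rw [Real.logb_div hδ.ne' hm.ne', Real.logb_pow, Real.logb_self_eq_one one_lt_two,
            mul_one]
      _ ≤ Real.logb 2 (1 / 2 - err) :=
          Real.logb_le_logb_of_le one_lt_two (by positivity) (by linarith)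
  have h2 := Int.floor_le_floor h1
  rw [Int.floor_sub_natCast] at h2
  rw [weaklyUnboundedCost]
  linarith

variable {X Y : Type*} {f : X → Y → Bool} {m : ℕ} {δ : ℝ}

theorem SignDecomposition.exists_mem_classicalCosts (hδ : 0 < δ) (hδ' : δ ≤ 1)
    (hf : SignDecomposition f m δ) :
    ∃ k ∈ classicalCosts f, (k : ℤ) ≤ 2 * m + 4 - ⌊Real.logb 2 δ⌋ := by
  obtain ⟨P, hc, hP⟩ := hf.exists_randomizedProtocol hδ
  have hlt : (0 : ℝ) < δ / 2 ^ (m + 2) := by positivity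
  have herr : P.error f ≤ 1 / 2 - δ / 2 ^ (m + 2) := by
    refine Real.iSup_le (fun p => hP p.1 p.2) ?_
    -- The bound on the error has to be nonnegative because the supremum over an empty set of inputs
    -- is `0`; this is where `δ ≤ 1` is used.
    have : δ / 2 ^ (m + 2) ≤ 1 / 2 ^ 1 := by
      gcongr
      · norm_num
      · omega
    linarith
  have hcost := weaklyUnboundedCost_le (c := P.comm) hδ herr
  have hnonneg := comm_lt_weaklyUnboundedCost P.comm (P.error_nonneg f) (by linarith)
  lift weaklyUnboundedCost P.comm (P.error f) to ℕ using by omega with k hk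
  refine ⟨k, ⟨P, by linarith, hk⟩, ?_⟩
  rw [hc] at hcost
  push_cast at hcost
  linarith

theorem SignDecomposition.exists_mem_quantumCosts [Finite X] [Finite Y] (hδ : 0 < δ) (hδ' : δ ≤ 1)
    (hf : SignDecomposition f m δ) :
    ∃ k ∈ quantumCosts f, (k : ℤ) ≤ 2 * m + 3 - ⌊Real.logb 2 δ⌋ := by
  obtain ⟨P, hc, hP⟩ := hf.exists_quantumProtocol
  have hlt : (0 : ℝ) < δ / 2 ^ (m + 1) := by positivity
  have herr : P.error f ≤ 1 / 2 - δ / 2 ^ (m + 1) := by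
    refine Real.iSup_le (fun p => hP p.1 p.2) ?_
    have : δ / 2 ^ (m + 1) ≤ 1 / 2 ^ 1 := by
      gcongr
      · norm_num
      · omega
    linarith
  have hcost := weaklyUnboundedCost_le (c := P.comm) hδ herr
  have hnonneg := comm_lt_weaklyUnboundedCost P.comm (P.error_nonneg f) (by linarith)
  lift weaklyUnboundedCost P.comm (P.error f) to ℕ using by omega with k hk
  refine ⟨k, ⟨P, by linarith, hk⟩, ?_⟩
  rw [hc] at hcost
  push_cast at hcost
  linarith

variable [Finite X] (f)

theorem classicalCosts_nonempty : (classicalCosts f).Nonempty := by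
  obtain ⟨m, hm⟩ := exists_signDecomposition f
  obtain ⟨k, hk, -⟩ := hm.exists_mem_classicalCosts one_pos le_rfl
  exact ⟨k, hk⟩

variable [Finite Y]

theorem quantumCosts_nonempty : (quantumCosts f).Nonempty := by
  obtain ⟨m, hm⟩ := exists_signDecomposition f
  obtain ⟨k, hk, -⟩ := hm.exists_mem_quantumCosts one_pos le_rfl
  exact ⟨k, hk⟩

/-- For an optimal classical protocol with `c` bits, the quantum cost is at most `PC f + c + 3`; now
`c + 1 ≤ PC f` and `1 ≤ PC f`. -/
theorem QC_le_PC : QC f ≤ 4 * PC f := by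
  obtain ⟨P, herr, hP⟩ := Nat.sInf_mem (classicalCosts_nonempty f)
  have h₀ := P.error_nonneg f
  obtain ⟨k, hk, hle⟩ := (P.signDecomposition f herr).exists_mem_quantumCosts (by linarith)
    (by linarith)
  have h1 : QC f ≤ k := Nat.sInf_le hk
  have h2 := comm_lt_weaklyUnboundedCost P.comm h₀ herr
  rw [← hP] at h2
  rw [weaklyUnboundedCost] at hP
  change ((PC f : ℕ) : ℤ) = _ at hP
  change _ ≤ ((PC f : ℕ) : ℤ) at h2
  omega

/-- Here `m = 2 * c + 1`, so the classical cost is at most `QC f + 3 * c + 6`, hence at most `4 * QC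
f + 3`. -/
theorem PC_le_QC : PC f ≤ 7 * QC f := by
  obtain ⟨P, herr, hP⟩ := Nat.sInf_mem (quantumCosts_nonempty f)
  have h₀ := P.error_nonneg f
  obtain ⟨k, hk, hle⟩ := (P.signDecomposition f herr).exists_mem_classicalCosts (by linarith)
    (by linarith)
  have h1 : PC f ≤ k := Nat.sInf_le hk
  have h2 := comm_lt_weaklyUnboundedCost P.comm h₀ herr
  rw [← hP] at h2
  rw [weaklyUnboundedCost] at hP
  change ((QC f : ℕ) : ℤ) = _ at hP
  change _ ≤ ((QC f : ℕ) : ℤ) at h2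
  push_cast at hle
  omega

end CommComplexity

theorem theorem8p4 :
    ∃ a b : ℝ, 0 < a ∧ 0 < b ∧
      ∀ (X : Type*) (Y : Type*) [Finite X] [Finite Y] (f : X → Y → Bool),
        (CommComplexity.classicalCosts f).Nonempty ∧
        (CommComplexity.quantumCosts f).Nonempty ∧
        a * (CommComplexity.QC f : ℝ) ≤ (CommComplexity.PC f : ℝ) ∧
        (CommComplexity.PC f : ℝ) ≤ b * (CommComplexity.QC f : ℝ) := by
  refine ⟨1 / 4, 7, by norm_num, by norm_num, fun X Y _ _ f =>
    ⟨CommComplexity.classicalCosts_nonempty f, CommComplexity.quantumCosts_nonempty f, ?_, ?_⟩⟩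
  · have : (CommComplexity.QC f : ℝ) ≤ 4 * CommComplexity.PC f :=
      mod_cast CommComplexity.QC_le_PC f
    linarith
  · exact_mod_cast CommComplexity.PC_le_QC f
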